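/- **Setting.** A *two-player win-lose coordination game* $G$ consists of finite non-empty disjoint choice sets $C_1,C_2$ and a winning relation $W\subseteq C_1\times C_2$ such that every choice belongs to some winning profile. In repeated play, in each round both players simultaneously pick a choice, seeing the full history of previously picked profiles; the play stops as soon as a winning profile is picked. A *stage* $(G,\mathcal H)$ is a game with a finite sequence $\mathcal H$ of choice profiles (its history); it is *final* if a winning profile occurs in $\mathcal H$. A *renaming* between two stages is a permutation of the players together with a bijection between the domains that respects the choice sets (up to the permutation of players) and preserves the winning relation and each round of the history. A *protocol* assigns to every stage of every two-player game and every player role $i$ a probability distribution on $C_i$; all protocols are required to be *structural*, i.e. invariant under renamings of stages. The *expected coordination time* (ECT) of a protocol in $G$ is the expected number of rounds until coordination (possibly $\infty$) when both players follow the protocol, randomizing independently, from the stage with empty history. A protocol is *ECT-optimal* for $G$ if no protocol has a smaller ECT in $G$. A non-final stage is *reachable* with a protocol if it occurs with positive probability when both players follow it. A protocol $\pi$ is *uniquely ECT-optimal* for $G$ if it is ECT-optimal and every ECT-optimal protocol for $G$ agrees with $\pi$ at all stages of $G$ reachable with $\pi$. The game $\mathrm{CM}_4$ is the two-player game in which each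 player has four choices and the winning profiles are four pairwise disjoint pairs. The *wait-or-move protocol* WM is the following: the first choice is uniformly random; at a later non-final stage, if each player has picked only one choice so far (possibly several times), play with probability $\tfrac12$ one's own earlier choice, and with total probability $\tfrac12$, uniformly, one of the choices that coordinate with the other player's earlier choice; if each player has picked exactly two choices so far, play each of one's own two earlier choices with probability $\tfrac12$; at all other stages choose uniformly at random. **Theorem.** WM is ECT-optimal for $\mathrm{CM}_4$, and the optimal ECT is $2+\tfrac12$. There are, however, continuum many other ECT-optimal protocols for $\mathrm{CM}_4$: the set of restrictions to the stages of $\mathrm{CM}_4$ of ECT-optimal protocols, without the restriction of WM, has cardinality exactly $2^{\aleph_0}$, and the same is true if each protocol is restricted to only those (non-final) stages of $\mathrm{CM}_4$ that are reachable with it. Consequently no protocol is uniquely ECT-optimal for $\mathrm{CM}_4$. -/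

import Mathlib

open scoped ENNReal Cardinal

noncomputable section

/-- An `n`-player win-lose coordination game. The disjoint choice sets of the players are the
types `Choice i` (the domain of the game is their disjoint union), `Win` is the winning
relation, and there are no surely losing choices. -/
structure WLCGame (n : ℕ) where
  Choice : Fin n → Type
  fintypeChoice : ∀ i, Fintype (Choice i)
  nonemptyChoice : ∀ i, Nonempty (Choice i)
  Win : Set (∀ i, Choice i)
  no_losing : ∀ (i : Fin n) (c : Choice i), ∃ σ ∈ Win, σ i = c

attribute [instance] WLCGame.fintypeChoice WLCGame.nonemptyChoice

namespace WLCGame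

variable {n : ℕ}

/-- Choice profiles. -/
abbrev Profile (G : WLCGame n) : Type := ∀ i, G.Choice i

end WLCGame

/-- The choice matching game with `n` players and `m` choices for each player: the `m` winning
profiles are the pairwise disjoint constant ones. -/
def choiceMatching (n m : ℕ) [NeZero m] : WLCGame n where
  Choice _ := Fin m
  fintypeChoice _ := inferInstance
  nonemptyChoice _ := inferInstance
  Win := {σ | ∀ i j, σ i = σ j}
  no_losing _ c := ⟨fun _ => c, fun _ _ => rfl, rfl⟩

/-- The two-player choice matching game with `m` choices. -/
abbrev CM (m : ℕ) [NeZero m] : WLCGame 2 := choiceMatching 2 m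

/-- A stage of a repeated play: a game with the sequence of the choice profiles played so far
(in the order in which they were played). -/
structure Stage (n : ℕ) where
  game : WLCGame n
  history : List game.Profile

namespace Stage

variable {n : ℕ}

/-- The initial stage of a game. -/
def initial (G : WLCGame n) : Stage n := ⟨G, []⟩

/-- The stage that results when the profile `σ` is played at `S`. -/
def extend (S : Stage n) (σ : S.game.Profile) : Stage n := ⟨S.game, S.history ++ [σ]⟩

/-- Coordination has already happened. -/
def IsFinal (S : Stage n) : Prop := ∃ σ ∈ S.history, σ ∈ S.game.Win

open Classical in
/-- The set of the choices that player `i` has selected in the previous rounds. -/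
def played (S : Stage n) (i : Fin n) : Finset (S.game.Choice i) :=
  (S.history.map fun σ => σ i).toFinset

end Stage

/-- A renaming between two stages: a permutation `perm` of the players together with a bijection
between the domains mapping the choices of player `perm i` onto those of player `i`, which
preserves the winning relation (in both directions) and every round of the history. -/
structure Renaming {n : ℕ} (S S' : Stage n) where
  perm : Equiv.Perm (Fin n)
  toEquiv : ∀ i, S.game.Choice (perm i) ≃ S'.game.Choice i
  win_iff : ∀ σ : S.game.Profile,
    σ ∈ S.game.Win ↔ (fun i => toEquiv i (σ (perm i))) ∈ S'.game.Win
  history_eq : S'.history = S.history.map fun σ i => toEquiv i (σ (perm i))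

/-- A (not necessarily structural) protocol: a mixed strategy for every player role at every
stage of every `n`-player game. -/
abbrev Protocol (n : ℕ) : Type 1 := (S : Stage n) → (i : Fin n) → PMF (S.game.Choice i)

namespace Protocol

variable {n : ℕ}

/-- A protocol is structural if it is indifferent with respect to renamings. -/
def IsStructural (π : Protocol n) : Prop :=
  ∀ (S S' : Stage n) (r : Renaming S S') (i : Fin n) (c : S.game.Choice (r.perm i)),
    π S (r.perm i) c = π S' i (r.toEquiv i c)

/-- The probability that the profile `σ` is played at `S` when all players follow `π`
(independently of each other). -/
def profileProb (π : Protocol n) (S : Stage n) (σ : S.game.Profile) : ℝ≥0∞ :=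
  ∏ i, π S i (σ i)

open Classical in
/-- The probability that, starting from `S` with all players following `π`, coordination is
reached after exactly `k` further rounds. -/
def coordProb (π : Protocol n) : ℕ → Stage n → ℝ≥0∞
  | 0, S => if S.IsFinal then 1 else 0
  | k + 1, S =>
      if S.IsFinal then 0
      else ∑ σ : S.game.Profile, π.profileProb S σ * coordProb π k (S.extend σ)

/-- The expected coordination time from `S` with `π`: the expected value of the number of rounds
until coordination. The second summand accounts for the plays that never coordinate, for which
this number is infinite (with the convention `∞ * 0 = 0`). -/
def ect (π : Protocol n) (S : Stage n) : ℝ≥0∞ :=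
  ∑' k : ℕ, (k : ℝ≥0∞) * π.coordProb k S + ⊤ * (1 - ∑' k : ℕ, π.coordProb k S)

/-- `π` is a structural protocol with the minimum expected coordination time in `G` among all
structural protocols. -/
def IsECTOptimal (π : Protocol n) (G : WLCGame n) : Prop :=
  π.IsStructural ∧
    ∀ π' : Protocol n, π'.IsStructural → π.ect (Stage.initial G) ≤ π'.ect (Stage.initial G)

/-- `π.Reachable G H`: the non-final stage `(G, H)` is reached with positive probability from
the initial stage of `G` when all players follow `π`. (Final stages are left out: there the play
has ended, and no further choices are made.) -/
inductive Reachable (π : Protocol n) (G : WLCGame n) : List G.Profile → Prop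
  | initial : Reachable π G []
  | step (H : List G.Profile) (σ : G.Profile) :
      Reachable π G H → σ ∉ G.Win → π.profileProb ⟨G, H⟩ σ ≠ 0 → Reachable π G (H ++ [σ])

/-- Unique optimality: every optimal protocol acts as `π` does at all stages that are reachable
with `π`. -/
def IsUniquelyECTOptimal (π : Protocol n) (G : WLCGame n) : Prop :=
  π.IsECTOptimal G ∧
    ∀ π' : Protocol n, π'.IsECTOptimal G →
      ∀ H : List G.Profile, π.Reachable G H → π' ⟨G, H⟩ = π ⟨G, H⟩

/-- The restriction of `π` to the stages of `G`. -/
def restrict (π : Protocol n) (G : WLCGame n) :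
    List G.Profile → ∀ i, PMF (G.Choice i) :=
  fun H => π ⟨G, H⟩

open Classical in
/-- The restriction of `π` to those stages of `G` that are reachable with `π` (as a partial
function on the histories). -/
def reachableRestrict (π : Protocol n) (G : WLCGame n) :
    List G.Profile → Option (∀ i, PMF (G.Choice i)) :=
  fun H => if π.Reachable G H then some (π ⟨G, H⟩) else none

end Protocol

open Classical in
/-- In a two-player game, the choices of player `i` that coordinate with the choice `c` of the
other player `i.rev`. -/
def coordinating (G : WLCGame 2) (i : Fin 2) (c : G.Choice i.rev) : Finset (G.Choice i) :=
  Finset.univ.filter fun d => ∃ σ ∈ G.Win, σ i = d ∧ σ i.rev = c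

theorem coordinating_nonempty (G : WLCGame 2) (i : Fin 2) (c : G.Choice i.rev) :
    (coordinating G i c).Nonempty := by
  obtain ⟨σ, hσ, h⟩ := G.no_losing i.rev c
  exact ⟨σ i, by simpa [coordinating] using ⟨σ, hσ, rfl, h⟩⟩

theorem played_cons_nonempty {n : ℕ} (G : WLCGame n) (σ : G.Profile) (H : List G.Profile)
    (i : Fin n) : ((Stage.mk G (σ :: H)).played i).Nonempty :=
  ⟨σ i, by simp [Stage.played]⟩

open Classical in
/-- The wait-or-move protocol. The first choice is uniformly random. At a non-final stage,
* if each player has selected only a single choice so far, play one's own earlier choice with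
  probability `1/2` and, with probability `1/2`, a uniformly random choice among those that
  coordinate with the earlier choice of the other player;
* if each player has selected exactly two choices so far, play each of one's own two earlier
  choices with probability `1/2`.
At all other stages, the choice is uniformly random. -/
def waitOrMove : Protocol 2
  | ⟨_, []⟩, _ => PMF.uniformOfFintype _
  | ⟨G, σ :: H⟩, i =>
      let S : Stage 2 := ⟨G, σ :: H⟩
      if S.IsFinal then PMF.uniformOfFintype _
      else if ∀ j, (S.played j).card = 1 then
        (PMF.uniformOfFintype Bool).bind fun b =>
          if b then PMF.pure (σ i)
          else PMF.uniformOfFinset (coordinating G i (σ i.rev)) (coordinating_nonempty G i _)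
      else if ∀ j, (S.played j).card = 2 then
        PMF.uniformOfFinset (S.played i) (played_cons_nonempty G σ H i)
      else PMF.uniformOfFintype _

end

namespace Protocol

section Recursion

variable {n : ℕ} (π : Protocol n) (S : Stage n)

theorem isFinal_extend_iff (σ : S.game.Profile) :
    (S.extend σ).IsFinal ↔ S.IsFinal ∨ σ ∈ S.game.Win := by
  change (∃ τ ∈ S.history ++ [σ], τ ∈ S.game.Win) ↔ _
  simp only [Stage.IsFinal, List.mem_append, List.mem_singleton, or_and_right, exists_or,
    exists_eq_left]

theorem sum_profileProb : ∑ σ : S.game.Profile, π.profileProb S σ = 1 := by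
  classical
  have h := (Finset.prod_univ_sum (fun i => (Finset.univ : Finset (S.game.Choice i)))
    (fun i c => π S i c)).symm
  rw [Fintype.piFinset_univ] at h
  refine Eq.trans ?_ (h.trans ?_)
  · exact Finset.sum_congr (by ext; simp) fun _ _ => rfl
  · refine Finset.prod_eq_one fun i _ => ?_
    rw [← tsum_fintype (L := SummationFilter.unconditional _), PMF.tsum_coe]

variable {S}

theorem coordProb_zero_of_not_isFinal (h : ¬ S.IsFinal) : π.coordProb 0 S = 0 := by
  simp [coordProb, h]

theorem coordProb_succ_of_not_isFinal (h : ¬ S.IsFinal) (k : ℕ) :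
    π.coordProb (k + 1) S =
      ∑ σ : S.game.Profile, π.profileProb S σ * π.coordProb k (S.extend σ) := by
  simp [coordProb, h]

theorem coordProb_zero_of_isFinal (h : S.IsFinal) : π.coordProb 0 S = 1 := by
  simp [coordProb, h]

theorem coordProb_succ_of_isFinal (h : S.IsFinal) (k : ℕ) : π.coordProb (k + 1) S = 0 := by
  simp [coordProb, h]

theorem sum_range_coordProb_le_one (N : ℕ) :
    ∀ S : Stage n, ∑ k ∈ Finset.range N, π.coordProb k S ≤ 1 := by
  induction N with
  | zero => simp
  | succ N ih =>
    intro S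
    rw [Finset.sum_range_succ']
    by_cases h : S.IsFinal
    · simp [coordProb_zero_of_isFinal π h, coordProb_succ_of_isFinal π h]
    · simp only [coordProb_zero_of_not_isFinal π h, coordProb_succ_of_not_isFinal π h, add_zero]
      rw [Finset.sum_comm, ← π.sum_profileProb S]
      refine Finset.sum_le_sum fun σ _ => ?_
      rw [← Finset.mul_sum]
      exact mul_le_of_le_one_right' (ih _)

variable (S) in
theorem tsum_coordProb_le_one : ∑' k, π.coordProb k S ≤ 1 :=
  ENNReal.tsum_le_of_sum_range_le fun N => π.sum_range_coordProb_le_one N S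

theorem tsum_coordProb_of_not_isFinal (h : ¬ S.IsFinal) :
    ∑' k, π.coordProb k S =
      ∑ σ : S.game.Profile, π.profileProb S σ * ∑' k, π.coordProb k (S.extend σ) := by
  rw [tsum_eq_zero_add' ENNReal.summable, coordProb_zero_of_not_isFinal π h, zero_add]
  simp only [coordProb_succ_of_not_isFinal π h]
  rw [Summable.tsum_finsetSum fun _ _ => ENNReal.summable]
  simp only [ENNReal.tsum_mul_left]

theorem ect_of_isFinal (h : S.IsFinal) : π.ect S = 0 := by
  have h1 : ∑' k, π.coordProb k S = 1 := by
    rw [tsum_eq_zero_add' ENNReal.summable, coordProb_zero_of_isFinal π h]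
    simp [coordProb_succ_of_isFinal π h]
  have h2 : ∑' k : ℕ, (k : ℝ≥0∞) * π.coordProb k S = 0 := by
    rw [ENNReal.tsum_eq_zero]
    rintro (_ | k)
    · simp
    · simp [coordProb_succ_of_isFinal π h]
  simp [ect, h1, h2]

/-- One-step analysis of the expected coordination time. -/
theorem ect_of_not_isFinal (h : ¬ S.IsFinal) :
    π.ect S = 1 + ∑ σ : S.game.Profile, π.profileProb S σ * π.ect (S.extend σ) := by
  have key : ∀ T : ℝ≥0∞, T ≤ 1 → T + ⊤ * (1 - T) = 1 + ⊤ * (1 - T) := by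
    intro T hT
    rcases hT.eq_or_lt with rfl | hT
    · rfl
    · rw [ENNReal.top_mul (tsub_pos_of_lt hT).ne']; simp
  have h1 : ∑' k : ℕ, (k : ℝ≥0∞) * π.coordProb k S = ∑ σ : S.game.Profile,
      π.profileProb S σ * (∑' k : ℕ, (k : ℝ≥0∞) * π.coordProb k (S.extend σ)) +
      ∑' k, π.coordProb k S := by
    rw [tsum_coordProb_of_not_isFinal π h, ← Finset.sum_add_distrib,
      tsum_eq_zero_add' ENNReal.summable]
    simp only [Nat.cast_zero, zero_mul, zero_add, coordProb_succ_of_not_isFinal π h,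
      Finset.mul_sum]
    rw [Summable.tsum_finsetSum fun _ _ => ENNReal.summable]
    refine Finset.sum_congr rfl fun σ _ => ?_
    rw [← mul_add, ← ENNReal.tsum_add, ← ENNReal.tsum_mul_left]
    refine tsum_congr fun k => ?_
    push_cast
    ring
  have h2 : 1 - ∑' k, π.coordProb k S =
      ∑ σ : S.game.Profile, π.profileProb S σ * (1 - ∑' k, π.coordProb k (S.extend σ)) := by
    refine ENNReal.sub_eq_of_eq_add
      ((π.tsum_coordProb_le_one S).trans_lt ENNReal.one_lt_top).ne ?_
    rw [tsum_coordProb_of_not_isFinal π h, ← Finset.sum_add_distrib]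
    simp only [← mul_add]
    refine (π.sum_profileProb S).symm.trans (Finset.sum_congr rfl fun σ _ => ?_)
    rw [tsub_add_cancel_of_le (π.tsum_coordProb_le_one _), mul_one]
  unfold ect
  rw [h1, add_assoc, key _ (π.tsum_coordProb_le_one S), h2, add_left_comm]
  congr 1
  rw [Finset.mul_sum, ← Finset.sum_add_distrib]
  refine Finset.sum_congr rfl fun σ _ => ?_
  ring

theorem one_le_ect (h : ¬ S.IsFinal) : 1 ≤ π.ect S := by
  rw [ect_of_not_isFinal π h]; exact le_self_add

end Recursion

section Geometric

theorem tsum_coe_mul_half_pow : ∑' k : ℕ, (k : ℝ≥0∞) * (1 / 2) ^ k = 2 := by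
  have h := hasSum_coe_mul_geometric_of_norm_lt_one (𝕜 := ℝ) (r := 1 / 2) (by norm_num)
  have h2 : ∀ k : ℕ, (k : ℝ≥0∞) * (1 / 2) ^ k = ENNReal.ofReal ((k : ℝ) * (1 / 2) ^ k) := by
    intro k
    rw [ENNReal.ofReal_mul (by positivity), ENNReal.ofReal_pow (by norm_num),
      ENNReal.ofReal_natCast]
    congr 2
    rw [ENNReal.ofReal_div_of_pos (by norm_num)]; simp
  simp_rw [h2]
  rw [← ENNReal.ofReal_tsum_of_nonneg (fun k => by positivity) h.summable, h.tsum_eq]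
  norm_num

/-- If from a set of stages, closed under unsuccessful rounds, each round coordinates with
probability `1/2`, then the expected coordination time from these stages is `2`. -/
theorem ect_eq_two_of_win_prob_half {n : ℕ} (π : Protocol n) {G : WLCGame n}
    (K : List G.Profile → Prop) (hK : ∀ H, K H → ¬ (Stage.mk G H).IsFinal)
    (hwin : ∀ H, K H → ∑ σ : G.Profile, G.Win.indicator (π.profileProb ⟨G, H⟩) σ = 1 / 2)
    (hstay : ∀ H, K H → ∀ σ ∉ G.Win, π.profileProb ⟨G, H⟩ σ ≠ 0 → K (H ++ [σ]))
    {H : List G.Profile} (hH : K H) : π.ect ⟨G, H⟩ = 2 := by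
  have hlose : ∀ H, K H →
      ∑ σ : G.Profile, (G.Winᶜ).indicator (π.profileProb ⟨G, H⟩) σ = 1 / 2 := by
    intro H hH
    have h1 := π.sum_profileProb ⟨G, H⟩
    have h2 : ∑ σ : G.Profile, π.profileProb ⟨G, H⟩ σ =
      ∑ σ : G.Profile, G.Win.indicator (π.profileProb ⟨G, H⟩) σ +
      ∑ σ : G.Profile, (G.Winᶜ).indicator (π.profileProb ⟨G, H⟩) σ := by
      rw [← Finset.sum_add_distrib]
      exact Finset.sum_congr rfl fun σ _ =>
        (congrFun (Set.indicator_self_add_compl G.Win (π.profileProb ⟨G, H⟩)) σ).symm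
    have h3 := h2.symm.trans h1
    rw [hwin H hH] at h3
    have : (1 / 2 : ℝ≥0∞) ≠ ⊤ := by simp
    refine (ENNReal.add_right_inj this).1 (h3.trans ?_)
    rw [ENNReal.add_halves]
  have hk : ∀ k, ∀ H, K H → π.coordProb (k + 1) ⟨G, H⟩ = (1 / 2) ^ (k + 1) := by
    intro k
    induction k with
    | zero =>
      intro H hH
      rw [coordProb_succ_of_not_isFinal π (hK H hH), zero_add, pow_one, ← hwin H hH]
      refine Finset.sum_congr rfl fun σ _ => ?_
      by_cases hσ : σ ∈ G.Win
      · rw [coordProb_zero_of_isFinal, Set.indicator_of_mem hσ, mul_one]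
        exact (isFinal_extend_iff _ σ).2 (Or.inr hσ)
      · rw [coordProb_zero_of_not_isFinal, Set.indicator_of_notMem hσ, mul_zero]
        exact fun h => ((isFinal_extend_iff _ σ).1 h).elim (hK H hH) hσ
    | succ k ih =>
      intro H hH
      rw [coordProb_succ_of_not_isFinal π (hK H hH), pow_succ']
      conv_rhs => enter [1]; rw [← hlose H hH]
      refine Eq.trans (Finset.sum_congr rfl fun σ _ => ?_) (Finset.sum_mul _ _ _).symm
      by_cases hσ : σ ∈ G.Win
      · rw [coordProb_succ_of_isFinal, Set.indicator_of_notMem (by simpa using hσ), mul_zero,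
          zero_mul]
        exact (isFinal_extend_iff _ σ).2 (Or.inr hσ)
      · rw [Set.indicator_of_mem (by simpa using hσ)]
        by_cases h0 : π.profileProb ⟨G, H⟩ σ = 0
        · simp only [h0, zero_mul]
        · congr 1
          exact ih _ (hstay H hH σ hσ h0)
  have hk' : ∀ k : ℕ, (k : ℝ≥0∞) * π.coordProb k ⟨G, H⟩ = k * (1 / 2) ^ k := by
    rintro (_ | k)
    · simp
    · rw [hk k H hH]
  have hT : ∑' k, π.coordProb k ⟨G, H⟩ = 1 := by
    rw [tsum_eq_zero_add' ENNReal.summable, coordProb_zero_of_not_isFinal π (hK H hH), zero_add]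
    simp_rw [hk _ H hH, one_div]
    rw [ENNReal.tsum_geometric_add_one, ENNReal.one_sub_inv_two, inv_inv,
      ENNReal.inv_mul_cancel (by norm_num) (by norm_num)]
  simp only [ect, hk', hT, tsum_coe_mul_half_pow]
  simp

end Geometric

end Protocol

namespace Renaming

variable {n : ℕ} {S S' : Stage n}

/-- The action of a renaming on profiles. -/
def mapProfile (r : Renaming S S') (σ : S.game.Profile) : S'.game.Profile :=
  fun i => r.toEquiv i (σ (r.perm i))

theorem mapProfile_surjective (r : Renaming S S') : Function.Surjective r.mapProfile := by
  intro τ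
  refine ⟨fun j => (Equiv.piCongrLeft S.game.Choice r.perm) (fun i => (r.toEquiv i).symm (τ i)) j,
    funext fun i => ?_⟩
  simp [mapProfile, Equiv.piCongrLeft_apply_apply]

theorem mem_win_iff (r : Renaming S S') (σ : S.game.Profile) :
    r.mapProfile σ ∈ S'.game.Win ↔ σ ∈ S.game.Win :=
  (r.win_iff σ).symm

theorem history_eq_map (r : Renaming S S') : S'.history = S.history.map r.mapProfile := r.history_eq

theorem isFinal_iff (r : Renaming S S') : S'.IsFinal ↔ S.IsFinal := by
  simp [Stage.IsFinal, r.history_eq_map, r.mem_win_iff]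

theorem played_eq (r : Renaming S S') (i : Fin n) :
    S'.played i = (S.played (r.perm i)).map (r.toEquiv i).toEmbedding := by
  classical
  ext c
  simp [Stage.played, r.history_eq_map, mapProfile, Equiv.eq_symm_apply]

theorem card_played (r : Renaming S S') (i : Fin n) :
    (S'.played i).card = (S.played (r.perm i)).card := by
  rw [r.played_eq, Finset.card_map]

theorem forall_card_played_iff (r : Renaming S S') (m : ℕ) :
    (∀ i, (S'.played i).card = m) ↔ ∀ i, (S.played i).card = m := by
  simp only [r.card_played]
  exact r.perm.forall_congr_right (q := fun i => (S.played i).card = m)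

end Renaming

theorem mem_coordinating {G : WLCGame 2} {i : Fin 2} {c : G.Choice i.rev} {d : G.Choice i} :
    d ∈ coordinating G i c ↔ ∃ σ ∈ G.Win, σ i = d ∧ σ i.rev = c := by
  simp [coordinating]

theorem Equiv.Perm.apply_rev_fin_two (e : Equiv.Perm (Fin 2)) (i : Fin 2) :
    (e i).rev = e i.rev := by
  revert e i; decide

theorem Renaming.coordinating_eq {S S' : Stage 2} (r : Renaming S S') (σ : S.game.Profile)
    (i : Fin 2) :
    coordinating S'.game i (r.mapProfile σ i.rev) =
      (coordinating S.game (r.perm i) (σ (r.perm i).rev)).map (r.toEquiv i).toEmbedding := by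
  ext c
  rw [Finset.mem_map_equiv, mem_coordinating, mem_coordinating, r.mapProfile_surjective.exists]
  refine exists_congr fun τ => ?_
  rw [r.mem_win_iff, Equiv.Perm.apply_rev_fin_two, Equiv.eq_symm_apply]
  simp [Renaming.mapProfile]

theorem PMF.uniformOfFinset_map_equiv {α β : Type*} (e : α ≃ β) {s : Finset α} {t : Finset β}
    (hs : s.Nonempty) (ht : t.Nonempty) (h : t = s.map e.toEmbedding) (a : α) :
    PMF.uniformOfFinset s hs a = PMF.uniformOfFinset t ht (e a) := by
  classical
  subst h
  simp [PMF.uniformOfFinset_apply]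

theorem PMF.uniformOfFintype_equiv {α β : Type*} [Fintype α] [Nonempty α] [Fintype β] [Nonempty β]
    (e : α ≃ β) (a : α) : PMF.uniformOfFintype α a = PMF.uniformOfFintype β (e a) := by
  simp [Fintype.card_congr e]

theorem PMF.pure_equiv {α β : Type*} (e : α ≃ β) (a b : α) :
    PMF.pure a b = PMF.pure (e a) (e b) := by
  classical
  simp [PMF.pure_apply]

open Classical in
theorem waitOrMove_cons (G : WLCGame 2) (σ : G.Profile) (H : List G.Profile) (i : Fin 2) :
    waitOrMove ⟨G, σ :: H⟩ i =
      if (Stage.mk G (σ :: H)).IsFinal then PMF.uniformOfFintype _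
      else if ∀ j, ((Stage.mk G (σ :: H)).played j).card = 1 then
        (PMF.uniformOfFintype Bool).bind fun b =>
          if b then PMF.pure (σ i)
          else PMF.uniformOfFinset (coordinating G i (σ i.rev)) (coordinating_nonempty G i _)
      else if ∀ j, ((Stage.mk G (σ :: H)).played j).card = 2 then
        PMF.uniformOfFinset ((Stage.mk G (σ :: H)).played i) (played_cons_nonempty G σ H i)
      else PMF.uniformOfFintype _ := rfl

theorem waitOrMove_isStructural : waitOrMove.IsStructural := by
  rintro ⟨G, H⟩ ⟨G', H'⟩ ⟨perm, e, hw, hH⟩ i c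
  dsimp only at e hw hH c ⊢
  replace hH : H' = H.map (fun (σ : G.Profile) i => e i (σ (perm i))) := hH
  subst hH
  cases H with
  | nil => exact PMF.uniformOfFintype_equiv _ _
  | cons σ H =>
    let K : List G'.Profile := H.map fun (σ : G.Profile) i => e i (σ (perm i))
    let r : Renaming ⟨G, σ :: H⟩ ⟨G', (fun i => e i (σ (perm i))) :: K⟩ := ⟨perm, e, hw, rfl⟩
    change waitOrMove ⟨G, σ :: H⟩ (perm i) c =
      waitOrMove ⟨G', (fun i => e i (σ (perm i))) :: K⟩ i (e i c)
    rw [waitOrMove_cons, waitOrMove_cons]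
    by_cases hf : (Stage.mk G (σ :: H)).IsFinal
    · rw [if_pos hf, if_pos (r.isFinal_iff.2 hf)]
      exact PMF.uniformOfFintype_equiv _ _
    rw [if_neg hf, if_neg (mt r.isFinal_iff.1 hf)]
    by_cases h1 : ∀ j, ((Stage.mk G (σ :: H)).played j).card = 1
    · rw [if_pos h1, if_pos ((r.forall_card_played_iff 1).2 h1), PMF.bind_apply, PMF.bind_apply]
      refine tsum_congr fun b => ?_
      congr 1
      cases b
      · exact PMF.uniformOfFinset_map_equiv (e i) (coordinating_nonempty _ _ _)
          (coordinating_nonempty _ _ _) (r.coordinating_eq σ i) _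
      · exact (PMF.pure_equiv (e i) (σ (perm i)) c :)
    rw [if_neg h1, if_neg (mt (r.forall_card_played_iff 1).1 h1)]
    by_cases h2 : ∀ j, ((Stage.mk G (σ :: H)).played j).card = 2
    · rw [if_pos h2, if_pos ((r.forall_card_played_iff 2).2 h2)]
      exact PMF.uniformOfFinset_map_equiv (e i) _ _ (r.played_eq i) _
    · rw [if_neg h2, if_neg (mt (r.forall_card_played_iff 2).1 h2)]
      exact PMF.uniformOfFintype_equiv _ _

open Classical in
/-- The block of player `i` at the profile `σ`: the own choice in `σ` together with the choices
that coordinate with the choice of the other player, or the complement of this set. -/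
noncomputable def profileBlock (G : WLCGame 2) (σ : G.Profile) (i : Fin 2) (b : Bool) :
    Finset (G.Choice i) :=
  if b then insert (σ i) (coordinating G i (σ i.rev))
  else (insert (σ i) (coordinating G i (σ i.rev)))ᶜ

open Classical in
/-- The protocol that starts uniformly and, with `n + 1` rounds played, chooses uniformly from
the block of the first profile or from its complement, as directed by `s n`. -/
noncomputable def blockProtocol (s : ℕ → Bool) : Protocol 2
  | ⟨_, []⟩, _ => PMF.uniformOfFintype _
  | ⟨G, σ :: H⟩, i =>
      if h : (profileBlock G σ i (s H.length)).Nonempty then PMF.uniformOfFinset _ h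
      else PMF.uniformOfFintype _

theorem Renaming.profileBlock_eq {S S' : Stage 2} (r : Renaming S S') (σ : S.game.Profile)
    (i : Fin 2) (b : Bool) :
    profileBlock S'.game (r.mapProfile σ) i b =
      (profileBlock S.game σ (r.perm i) b).map (r.toEquiv i).toEmbedding := by
  ext c
  have h := Finset.ext_iff.1 (r.coordinating_eq σ i) c
  have h' : c = r.mapProfile σ i ↔ (r.toEquiv i).symm c = σ (r.perm i) :=
    (Equiv.symm_apply_eq _).symm
  rw [Finset.mem_map_equiv] at h ⊢
  cases b <;> simp [profileBlock, h, h']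

open Classical in
theorem blockProtocol_cons (s : ℕ → Bool) (G : WLCGame 2) (σ : G.Profile) (H : List G.Profile)
    (i : Fin 2) :
    blockProtocol s ⟨G, σ :: H⟩ i =
      if h : (profileBlock G σ i (s H.length)).Nonempty then PMF.uniformOfFinset _ h
      else PMF.uniformOfFintype _ := rfl

theorem blockProtocol_isStructural (s : ℕ → Bool) : (blockProtocol s).IsStructural := by
  rintro ⟨G, H⟩ ⟨G', H'⟩ ⟨perm, e, hw, hH⟩ i c
  dsimp only at e hw hH c ⊢
  replace hH : H' = H.map (fun (σ : G.Profile) i => e i (σ (perm i))) := hH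
  subst hH
  cases H with
  | nil => exact PMF.uniformOfFintype_equiv _ _
  | cons σ H =>
    let K : List G'.Profile := H.map fun (σ : G.Profile) i => e i (σ (perm i))
    let r : Renaming ⟨G, σ :: H⟩ ⟨G', (fun i => e i (σ (perm i))) :: K⟩ := ⟨perm, e, hw, rfl⟩
    have hb := r.profileBlock_eq σ i (s H.length)
    have hn : (profileBlock G' (fun i => e i (σ (perm i))) i (s H.length)).Nonempty ↔
        (profileBlock G σ (perm i) (s H.length)).Nonempty :=
      (congrArg Finset.Nonempty hb).to_iff.trans Finset.map_nonempty
    change blockProtocol s ⟨G, σ :: H⟩ (perm i) c =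
      blockProtocol s ⟨G', (fun i => e i (σ (perm i))) :: K⟩ i (e i c)
    rw [blockProtocol_cons, blockProtocol_cons]
    simp only [K, List.length_map]
    by_cases h : (profileBlock G σ (perm i) (s H.length)).Nonempty
    · rw [dif_pos h, dif_pos (hn.2 h)]
      exact PMF.uniformOfFinset_map_equiv (e i) _ _ hb _
    · rw [dif_neg h, dif_neg (mt hn.1 h)]
      exact PMF.uniformOfFintype_equiv _ _

/-- The profile of `CM 4` in which the players pick `x` and `y`. -/
def cmProfile (x y : Fin 4) : (CM 4).Profile := fun i => if i = 0 then x else y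

theorem cmProfile_eta (σ : (CM 4).Profile) : cmProfile (σ 0) (σ 1) = σ := by
  funext i; fin_cases i <;> rfl

theorem mem_win_cm_iff (σ : (CM 4).Profile) : σ ∈ (CM 4).Win ↔ σ 0 = σ 1 :=
  ⟨fun h => h 0 1, fun h i j => by
    fin_cases i <;> fin_cases j <;> first | rfl | exact h | exact h.symm⟩

theorem cmProfile_mem_win_iff {x y : Fin 4} : cmProfile x y ∈ (CM 4).Win ↔ x = y :=
  mem_win_cm_iff _

theorem sum_cm_profile {M : Type*} [AddCommMonoid M] (F : (CM 4).Profile → M) :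
    ∑ σ, F σ = ∑ x : Fin 4, ∑ y : Fin 4, F (cmProfile x y) := by
  rw [← Fintype.sum_prod_type' (f := fun x y => F (cmProfile x y))]
  exact Fintype.sum_equiv (finTwoArrowEquiv (Fin 4)) _ _ fun σ => congrArg F (cmProfile_eta σ).symm

theorem PMF.sum_coe {α : Type*} [Fintype α] (p : PMF α) : ∑ a, p a = 1 := by
  rw [← tsum_fintype (L := SummationFilter.unconditional _), PMF.tsum_coe]

namespace Protocol

variable (π : Protocol 2)

/-- The choice of player `i` at the stage of `CM 4` with history `H`, as a distribution on
`Fin 4`. -/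
def cmStrategy (H : List (CM 4).Profile) (i : Fin 2) : PMF (Fin 4) := π ⟨CM 4, H⟩ i

theorem profileProb_cmProfile (H : List (CM 4).Profile) (x y : Fin 4) :
    π.profileProb ⟨CM 4, H⟩ (cmProfile x y) = π.cmStrategy H 0 x * π.cmStrategy H 1 y :=
  Fin.prod_univ_two _

theorem ect_cm {H : List (CM 4).Profile} (h : ¬ (Stage.mk (CM 4) H).IsFinal) :
    π.ect ⟨CM 4, H⟩ = 1 + ∑ x : Fin 4, ∑ y : Fin 4,
      π.cmStrategy H 0 x * π.cmStrategy H 1 y * π.ect ⟨CM 4, H ++ [cmProfile x y]⟩ := by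
  rw [ect_of_not_isFinal π h]
  congr 1
  refine (sum_cm_profile _).trans ?_
  simp only [profileProb_cmProfile]
  rfl

end Protocol

/-- A history of `CM 4` in which all rounds are invariant under the exchange of the players
combined with a fixed-point-free involution of the choices. -/
def IsMirrored (f : Equiv.Perm (Fin 4)) (H : List (CM 4).Profile) : Prop :=
  (∀ x, f (f x) = x) ∧ (∀ x, f x ≠ x) ∧ ∀ σ ∈ H, σ 1 = f (σ 0)

namespace IsMirrored

variable {f : Equiv.Perm (Fin 4)} {H : List (CM 4).Profile}

theorem not_isFinal (h : IsMirrored f H) : ¬ (Stage.mk (CM 4) H).IsFinal := by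
  rintro ⟨σ, hσ, hw⟩
  exact h.2.1 (σ 0) ((h.2.2 σ hσ).symm.trans ((mem_win_cm_iff σ).1 hw).symm)

theorem append (h : IsMirrored f H) (x : Fin 4) : IsMirrored f (H ++ [cmProfile x (f x)]) := by
  refine ⟨h.1, h.2.1, fun σ hσ => ?_⟩
  rcases List.mem_append.1 hσ with hσ | hσ
  · exact h.2.2 σ hσ
  · obtain rfl := List.mem_singleton.1 hσ
    rfl

/-- The exchange of the players as a renaming. -/
def swapRenaming (h : IsMirrored f H) : Renaming (Stage.mk (CM 4) H) (Stage.mk (CM 4) H) where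
  perm := Equiv.swap 0 1
  toEquiv _ := f
  win_iff σ := by
    refine (mem_win_cm_iff σ).trans (Iff.trans ?_ (mem_win_cm_iff _).symm)
    exact eq_comm.trans f.injective.eq_iff.symm
  history_eq := by
    refine (List.map_id H).symm.trans (List.map_congr_left fun σ hσ => ?_)
    have h1 := h.2.2 σ hσ
    funext i
    fin_cases i
    · exact ((congrArg f h1).trans (h.1 _)).symm
    · exact h1

theorem strategy_eq (h : IsMirrored f H) {π : Protocol 2} (hπ : π.IsStructural) (y : Fin 4) :
    π.cmStrategy H 1 y = π.cmStrategy H 0 (f y) :=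
  hπ _ _ h.swapRenaming 0 y

end IsMirrored

theorem exists_isMirrored_singleton {x y : Fin 4} (hxy : x ≠ y) :
    ∃ f, IsMirrored f [cmProfile x y] := by
  have : ∀ x y : Fin 4, x ≠ y → ∃ f : Equiv.Perm (Fin 4),
      (∀ x, f (f x) = x) ∧ (∀ x, f x ≠ x) ∧ y = f x := by decide +kernel
  obtain ⟨f, h1, h2, h3⟩ := this x y hxy
  refine ⟨f, h1, h2, fun σ hσ => ?_⟩
  obtain rfl := List.mem_singleton.1 hσ
  exact h3

/-- The main estimate: against a mirrored opponent, winning at once is no more likely than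
staying mirrored. -/
theorem mirrored_estimate {ι : Type*} [Fintype ι] [DecidableEq ι] (P : ι → ℝ) (hP : ∀ x, 0 ≤ P x)
    (hsum : ∑ x, P x = 1) (f : Equiv.Perm ι) (hff : ∀ x, f (f x) = x) (hf : ∀ x, f x ≠ x)
    {ε : ℝ} (h0 : 0 ≤ ε) (h1 : ε ≤ 1) :
    2 - ε / 2 ≤ 1 + ∑ x, ∑ y, P x * P (f y) *
      (if x = y then 0 else if y = f x then 2 - ε else 1) := by
  have hinner : ∀ x, ∑ y, P x * P (f y) * (if x = y then 0 else if y = f x then 2 - ε else 1) =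
      P x - P x * P (f x) + (1 - ε) * (P x * P x) := by
    intro x
    have : ∀ y, P x * P (f y) * (if x = y then 0 else if y = f x then 2 - ε else 1) =
        P x * P (f y) - (if x = y then P x * P (f y) else 0) +
          (1 - ε) * (if f x = y then P x * P (f y) else 0) := by
      intro y
      by_cases hxy : x = y
      · subst hxy; simp [hf x]
      · by_cases hy : f x = y
        · subst hy; simp [(hf x).symm]; ring
        · simp [hxy, hy, Ne.symm hy]
    simp only [this, Finset.sum_add_distrib, Finset.sum_sub_distrib, ← Finset.mul_sum,
      Finset.sum_ite_eq, Finset.mem_univ, if_true, hff]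
    rw [Equiv.sum_comp f P, hsum, mul_one]
  simp only [hinner, Finset.sum_add_distrib, Finset.sum_sub_distrib, ← Finset.mul_sum, hsum]
  set A := ∑ x, P x * P x
  set B := ∑ x, P x * P (f x)
  have hAB : B ≤ A := by
    have h2 : 0 ≤ ∑ x, (P x - P (f x)) ^ 2 := Finset.sum_nonneg fun _ _ => sq_nonneg _
    have h3 : ∑ x, (P x - P (f x)) ^ 2 = A - 2 * B + ∑ x, P (f x) * P (f x) := by
      rw [Finset.mul_sum, ← Finset.sum_sub_distrib, ← Finset.sum_add_distrib]
      exact Finset.sum_congr rfl fun x _ => by ring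
    rw [Equiv.sum_comp f fun x => P x * P x] at h3
    linarith
  have hA : A + B ≤ 1 := by
    rw [← Finset.sum_add_distrib, ← hsum]
    refine Finset.sum_le_sum fun x _ => ?_
    have h2 : P x + P (f x) ≤ 1 := by
      rw [← hsum, ← Finset.sum_pair (f := P) (hf x).symm]
      exact Finset.sum_le_univ_sum_of_nonneg hP
    nlinarith [hP x]
  nlinarith

namespace Protocol

variable {π : Protocol 2}

theorem ect_mirrored_step (hπ : π.IsStructural) {ε : ℝ} (h0 : 0 ≤ ε) (h1 : ε ≤ 1)
    (h : ∀ f H, IsMirrored f H → ENNReal.ofReal (2 - ε) ≤ π.ect ⟨CM 4, H⟩)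
    {f : Equiv.Perm (Fin 4)} {H : List (CM 4).Profile} (hH : IsMirrored f H) :
    ENNReal.ofReal (2 - ε / 2) ≤ π.ect ⟨CM 4, H⟩ := by
  set P : Fin 4 → ℝ := fun x => (π.cmStrategy H 0 x).toReal with hPdef
  have hP : ∀ x, 0 ≤ P x := fun x => ENNReal.toReal_nonneg
  have hPe : ∀ x, π.cmStrategy H 0 x = ENNReal.ofReal (P x) := fun x =>
    (ENNReal.ofReal_toReal (PMF.apply_ne_top _ _)).symm
  have hsum : ∑ x, P x = 1 := by
    rw [← ENNReal.toReal_sum fun x _ => PMF.apply_ne_top _ _, PMF.sum_coe, ENNReal.toReal_one]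
  have hφ : ∀ x y : Fin 4, (0 : ℝ) ≤ if x = y then 0 else if y = f x then 2 - ε else 1 := by
    intro x y; split_ifs <;> linarith
  rw [ect_cm π hH.not_isFinal]
  refine (ENNReal.ofReal_le_ofReal
    (mirrored_estimate P hP hsum f hH.1 hH.2.1 h0 h1)).trans ?_
  rw [ENNReal.ofReal_add zero_le_one (Finset.sum_nonneg fun x _ => Finset.sum_nonneg fun y _ =>
    mul_nonneg (mul_nonneg (hP _) (hP _)) (hφ x y)), ENNReal.ofReal_one]
  refine add_le_add_right ?_ 1
  rw [ENNReal.ofReal_sum_of_nonneg fun x _ => Finset.sum_nonneg fun y _ =>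
    mul_nonneg (mul_nonneg (hP _) (hP _)) (hφ x y)]
  refine Finset.sum_le_sum fun x _ => ?_
  rw [ENNReal.ofReal_sum_of_nonneg fun y _ => mul_nonneg (mul_nonneg (hP _) (hP _)) (hφ x y)]
  refine Finset.sum_le_sum fun y _ => ?_
  rw [hH.strategy_eq hπ, hPe, hPe, ENNReal.ofReal_mul (mul_nonneg (hP _) (hP _)),
    ENNReal.ofReal_mul (hP _)]
  gcongr
  split_ifs with hxy hy
  · simp
  · subst hy
    exact h f _ (hH.append x)
  · rw [ENNReal.ofReal_one]
    refine one_le_ect π fun hfin => ?_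
    rcases (isFinal_extend_iff ⟨CM 4, H⟩ (cmProfile x y)).1 hfin with hfin | hfin
    · exact hH.not_isFinal hfin
    · exact hxy (cmProfile_mem_win_iff.1 hfin)

/-- From a mirrored stage, no structural protocol coordinates in fewer than two expected
rounds. -/
theorem two_le_ect_of_isMirrored (hπ : π.IsStructural) {f : Equiv.Perm (Fin 4)}
    {H : List (CM 4).Profile} (hH : IsMirrored f H) : 2 ≤ π.ect ⟨CM 4, H⟩ := by
  have key : ∀ k : ℕ, ∀ f H, IsMirrored f H →
      ENNReal.ofReal (2 - (1 / 2) ^ k) ≤ π.ect ⟨CM 4, H⟩ := by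
    intro k
    induction k with
    | zero =>
      intro f H hH
      refine le_trans ?_ (one_le_ect π hH.not_isFinal)
      norm_num
    | succ k ih =>
      intro f H hH
      rw [pow_succ, mul_one_div]
      exact ect_mirrored_step hπ (by positivity) (pow_le_one₀ (by norm_num) (by norm_num)) ih hH
  have hlim : Filter.Tendsto (fun k : ℕ => ENNReal.ofReal (2 - (1 / 2) ^ k)) Filter.atTop
      (nhds (ENNReal.ofReal (2 - 0))) :=
    (ENNReal.continuous_ofReal.tendsto _).comp (tendsto_const_nhds.sub
      (tendsto_pow_atTop_nhds_zero_of_lt_one (by norm_num) (by norm_num)))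
  rw [sub_zero, ENNReal.ofReal_ofNat] at hlim
  exact le_of_tendsto' hlim fun k => key k f H hH

theorem cmStrategy_nil (hπ : π.IsStructural) (i : Fin 2) (c : Fin 4) :
    π.cmStrategy [] i c = 1 / 4 := by
  have h : ∀ d, π.cmStrategy [] i d = π.cmStrategy [] i c := by
    intro d
    let r : Renaming (Stage.initial (CM 4)) (Stage.initial (CM 4)) :=
      { perm := 1
        toEquiv := fun _ => (Equiv.swap d c : Equiv.Perm (Fin 4))
        win_iff := fun σ => by
          refine (mem_win_cm_iff σ).trans (Iff.trans ?_ (mem_win_cm_iff _).symm)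
          exact (Equiv.swap d c).injective.eq_iff.symm
        history_eq := rfl }
    refine (hπ _ _ r i d).trans ?_
    exact congrArg (π.cmStrategy [] i) (Equiv.swap_apply_left (α := Fin 4) d c)
  have h2 := PMF.sum_coe (π.cmStrategy [] i)
  simp only [h, Finset.sum_const, Finset.card_univ, Fintype.card_fin, nsmul_eq_mul] at h2
  rw [ENNReal.eq_div_iff (by norm_num) (by norm_num)]
  exact_mod_cast h2

theorem not_isFinal_initial {n : ℕ} (G : WLCGame n) : ¬ (Stage.initial G).IsFinal := by
  rintro ⟨σ, hσ, -⟩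
  exact List.not_mem_nil hσ

theorem ect_initial_cm (hπ : π.IsStructural) :
    π.ect (Stage.initial (CM 4)) = 1 + ∑ x : Fin 4, ∑ y : Fin 4,
      1 / 16 * π.ect ⟨CM 4, [cmProfile x y]⟩ := by
  refine (ect_cm π (not_isFinal_initial _)).trans ?_
  have : (1 / 4 : ℝ≥0∞) * (1 / 4) = 1 / 16 := by
    rw [← ENNReal.toReal_eq_toReal_iff' (by finiteness) (by finiteness)]
    norm_num
  simp only [cmStrategy_nil hπ, this]
  rfl

theorem one_add_sum_off_diagonal :
    1 + ∑ x : Fin 4, ∑ y : Fin 4, 1 / 16 * (if x = y then 0 else 2 : ℝ≥0∞) = 2 + 1 / 2 := by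
  simp [Fin.sum_univ_four]
  rw [← ENNReal.toReal_eq_toReal_iff' (by finiteness) (by finiteness)]
  repeat rw [ENNReal.toReal_add (by finiteness) (by finiteness)]
  norm_num

theorem le_ect_initial_cm (hπ : π.IsStructural) :
    2 + 1 / 2 ≤ π.ect (Stage.initial (CM 4)) := by
  rw [ect_initial_cm hπ, ← one_add_sum_off_diagonal]
  gcongr with x _ y _
  split_ifs with hxy
  · exact zero_le
  · obtain ⟨f, hf⟩ := exists_isMirrored_singleton hxy
    exact two_le_ect_of_isMirrored hπ hf

theorem ect_initial_cm_eq (hπ : π.IsStructural)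
    (h : ∀ x y, x ≠ y → π.ect ⟨CM 4, [cmProfile x y]⟩ = 2) :
    π.ect (Stage.initial (CM 4)) = 2 + 1 / 2 := by
  rw [ect_initial_cm hπ, ← one_add_sum_off_diagonal]
  refine congrArg _ (Finset.sum_congr rfl fun x _ => Finset.sum_congr rfl fun y _ => ?_)
  congr 1
  split_ifs with hxy
  · exact ect_of_isFinal π ⟨_, List.mem_singleton_self _, cmProfile_mem_win_iff.2 hxy⟩
  · exact h x y hxy

theorem isECTOptimal_cm (hπ : π.IsStructural)
    (h : ∀ x y, x ≠ y → π.ect ⟨CM 4, [cmProfile x y]⟩ = 2) : π.IsECTOptimal (CM 4) :=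
  ⟨hπ, fun _ hπ' => (ect_initial_cm_eq hπ h).trans_le (le_ect_initial_cm hπ')⟩

end Protocol

namespace Protocol

/-- If both players choose uniformly from the same two choices, they coordinate with
probability `1/2`. -/
theorem win_prob_of_uniform_pair (π : Protocol 2) {H : List (CM 4).Profile} {B : Finset (Fin 4)}
    (hB : B.card = 2) (h : ∀ i c, π.cmStrategy H i c = if c ∈ B then 1 / 2 else 0) :
    ∑ σ, (CM 4).Win.indicator (π.profileProb ⟨CM 4, H⟩) σ = 1 / 2 := by
  classical
  have h1 : ∀ x y : Fin 4, (CM 4).Win.indicator (π.profileProb ⟨CM 4, H⟩) (cmProfile x y) =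
      if x = y then (if x ∈ B then 1 / 4 else 0) else 0 := by
    intro x y
    by_cases hxy : x = y
    · subst hxy
      rw [Set.indicator_of_mem (cmProfile_mem_win_iff.2 rfl), profileProb_cmProfile, h, h,
        if_pos rfl]
      split_ifs
      · rw [← ENNReal.toReal_eq_toReal_iff' (by finiteness) (by finiteness)]
        norm_num
      · simp
    · rw [Set.indicator_of_notMem (mt cmProfile_mem_win_iff.1 hxy), if_neg hxy]
  rw [sum_cm_profile]
  simp only [h1, Finset.sum_ite_eq, Finset.mem_univ, if_true]
  rw [Finset.sum_ite_mem, Finset.univ_inter, Finset.sum_const, hB, two_nsmul]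
  rw [← ENNReal.toReal_eq_toReal_iff' (by finiteness) (by finiteness),
    ENNReal.toReal_add (by finiteness) (by finiteness)]
  norm_num

end Protocol

theorem mem_coordinating_cm {i : Fin 2} {c : (CM 4).Choice i.rev} {d : (CM 4).Choice i} :
    d ∈ coordinating (CM 4) i c ↔ @Eq (Fin 4) d c := by
  refine mem_coordinating.trans ⟨?_, fun h => ?_⟩
  · rintro ⟨σ, hσ, rfl, rfl⟩
    exact hσ _ _
  · exact ⟨fun _ => d, fun _ _ => rfl, rfl, h⟩

theorem PMF.uniformOfFinset_apply_of_card_eq_two {α : Type*} [DecidableEq α] {s B : Finset α}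
    (hs : s.Nonempty) (h : ∀ a, a ∈ s ↔ a ∈ B) (hB : B.card = 2) (a : α) :
    PMF.uniformOfFinset s hs a = if a ∈ B then 1 / 2 else 0 := by
  obtain rfl : s = B := Finset.ext h
  simp [PMF.uniformOfFinset_apply, hB]

theorem PMF.bind_bool_apply {α : Type*} [DecidableEq α] {s : Finset α} (hs : s.Nonempty)
    {u v x y : α} (hxy : x ≠ y) (h : ∀ a, a ∈ s ↔ a = v) (huv : u = x ∧ v = y ∨ u = y ∧ v = x)
    (a : α) :
    ((PMF.uniformOfFintype Bool).bind fun b =>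
      if b then PMF.pure u else PMF.uniformOfFinset s hs) a =
      if a ∈ ({x, y} : Finset α) then 1 / 2 else 0 := by
  obtain rfl : s = {v} := Finset.ext fun a => by simp [h]
  rw [PMF.bind_apply, tsum_bool]
  rcases huv with ⟨rfl, rfl⟩ | ⟨rfl, rfl⟩ <;> by_cases hx : a = u <;> by_cases hy : a = v <;>
    simp_all [PMF.uniformOfFinset_apply, PMF.pure_apply]

section WaitOrMove

/-- The nonempty histories in which the players play `x` and `y` in one of the two orders in
each round. -/
def IsPairHistory (x y : Fin 4) (H : List (CM 4).Profile) : Prop :=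
  H ≠ [] ∧ ∀ σ ∈ H, σ = cmProfile x y ∨ σ = cmProfile y x

theorem IsPairHistory.not_isFinal {x y : Fin 4} {H : List (CM 4).Profile} (hxy : x ≠ y)
    (h : IsPairHistory x y H) : ¬ (Stage.mk (CM 4) H).IsFinal := by
  rintro ⟨σ, hσ, hw⟩
  rcases h.2 σ hσ with rfl | rfl
  · exact hxy (cmProfile_mem_win_iff.1 hw)
  · exact hxy (cmProfile_mem_win_iff.1 hw).symm

theorem mem_played {n : ℕ} {S : Stage n} {i : Fin n} {c : S.game.Choice i} :
    c ∈ S.played i ↔ ∃ σ ∈ S.history, σ i = c := by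
  simp [Stage.played]

theorem cmProfile_cases (i : Fin 2) (x y : Fin 4) :
    (cmProfile x y i = x ∧ cmProfile y x i = y ∧
      cmProfile x y i.rev = y ∧ cmProfile y x i.rev = x) ∨
    (cmProfile x y i = y ∧ cmProfile y x i = x ∧
      cmProfile x y i.rev = x ∧ cmProfile y x i.rev = y) := by
  fin_cases i
  · exact Or.inl ⟨rfl, rfl, rfl, rfl⟩
  · exact Or.inr ⟨rfl, rfl, rfl, rfl⟩

theorem waitOrMove_of_isPairHistory {x y : Fin 4} {H : List (CM 4).Profile} (hxy : x ≠ y)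
    (h : IsPairHistory x y H) (i : Fin 2) (c : Fin 4) :
    waitOrMove.cmStrategy H i c = if c ∈ ({x, y} : Finset (Fin 4)) then 1 / 2 else 0 := by
  have hfin := h.not_isFinal hxy
  obtain ⟨hne, hall⟩ := h
  obtain ⟨σ, T, rfl⟩ := List.exists_cons_of_ne_nil hne
  change waitOrMove ⟨CM 4, σ :: T⟩ i c = _
  rw [waitOrMove_cons, if_neg hfin]
  by_cases hboth : cmProfile x y ∈ σ :: T ∧ cmProfile y x ∈ σ :: T
  · have hp : ∀ j (d : (CM 4).Choice j), d ∈ (Stage.mk (CM 4) (σ :: T)).played j ↔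
        @Membership.mem (Fin 4) (Finset (Fin 4)) _ {x, y} d := by
      intro j d
      refine mem_played.trans ?_
      refine Iff.trans ?_ ((Finset.mem_insert (α := Fin 4)).trans
        (or_congr Iff.rfl (Finset.mem_singleton (α := Fin 4)))).symm
      constructor
      · rintro ⟨τ, hτ, rfl⟩
        rcases hall τ hτ with rfl | rfl <;> rcases cmProfile_cases j x y with h | h
        exacts [.inl h.1, .inr h.1, .inr h.2.1, .inl h.2.1]
      · rintro (hd | hd) <;> rcases cmProfile_cases j x y with h | h
        exacts [⟨_, hboth.1, h.1.trans hd.symm⟩, ⟨_, hboth.2, h.2.1.trans hd.symm⟩,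
          ⟨_, hboth.2, h.2.1.trans hd.symm⟩, ⟨_, hboth.1, h.1.trans hd.symm⟩]
    have hc : ∀ j, ((Stage.mk (CM 4) (σ :: T)).played j).card = 2 := fun j =>
      (congrArg Finset.card (Finset.ext (hp j))).trans (Finset.card_pair (α := Fin 4) hxy)
    rw [if_neg fun h1 => absurd ((h1 0).symm.trans (hc 0)) (by decide), if_pos hc]
    exact PMF.uniformOfFinset_apply_of_card_eq_two (α := Fin 4) _ (hp i) (Finset.card_pair hxy) c
  · have hσ : ∀ τ ∈ σ :: T, τ = σ := by
      have h1 := hall σ List.mem_cons_self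
      intro τ hτ
      rcases hall τ hτ with rfl | rfl <;> rcases h1 with rfl | rfl
      · rfl
      · exact absurd ⟨hτ, List.mem_cons_self⟩ hboth
      · exact absurd ⟨List.mem_cons_self, hτ⟩ hboth
      · rfl
    have hc : ∀ j, ((Stage.mk (CM 4) (σ :: T)).played j).card = 1 := by
      intro j
      rw [Finset.card_eq_one]
      refine ⟨σ j, Finset.ext fun d => mem_played.trans (Iff.trans ?_ Finset.mem_singleton.symm)⟩
      constructor
      · rintro ⟨τ, hτ, rfl⟩
        rw [hσ τ hτ]
      · rintro rfl
        exact ⟨σ, List.mem_cons_self, rfl⟩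
    rw [if_pos hc]
    refine PMF.bind_bool_apply (α := Fin 4) _ hxy (fun _ => mem_coordinating_cm) ?_ c
    rcases hall σ List.mem_cons_self with rfl | rfl <;> rcases cmProfile_cases i x y with h | h
    exacts [.inl ⟨h.1, h.2.2.1⟩, .inr ⟨h.1, h.2.2.1⟩, .inr ⟨h.2.1, h.2.2.2⟩,
      .inl ⟨h.2.1, h.2.2.2⟩]

theorem ect_waitOrMove_of_isPairHistory {x y : Fin 4} (hxy : x ≠ y) {H : List (CM 4).Profile}
    (hH : IsPairHistory x y H) : waitOrMove.ect ⟨CM 4, H⟩ = 2 := by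
  refine waitOrMove.ect_eq_two_of_win_prob_half (IsPairHistory x y)
    (fun H hH => hH.not_isFinal hxy) (fun H hH => ?_) (fun H hH σ hσ hp => ?_) hH
  · exact waitOrMove.win_prob_of_uniform_pair (Finset.card_pair hxy)
      (waitOrMove_of_isPairHistory hxy hH)
  · refine ⟨by simp, fun τ hτ => ?_⟩
    rcases List.mem_append.1 hτ with hτ | hτ
    · exact hH.2 τ hτ
    · obtain rfl := List.mem_singleton.1 hτ
      obtain ⟨a, b, rfl⟩ : ∃ a b, τ = cmProfile a b := ⟨_, _, (cmProfile_eta τ).symm⟩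
      rw [Protocol.profileProb_cmProfile, waitOrMove_of_isPairHistory hxy hH,
        waitOrMove_of_isPairHistory hxy hH] at hp
      rw [cmProfile_mem_win_iff] at hσ
      have ha : a ∈ ({x, y} : Finset (Fin 4)) := by
        by_contra h; exact hp (by rw [if_neg h, zero_mul])
      have hb : b ∈ ({x, y} : Finset (Fin 4)) := by
        by_contra h; exact hp (by rw [if_neg h, mul_zero])
      rw [Finset.mem_insert, Finset.mem_singleton] at ha hb
      rcases ha with rfl | rfl <;> rcases hb with rfl | rfl
      · exact absurd rfl hσ
      · exact Or.inl rfl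
      · exact Or.inr rfl
      · exact absurd rfl hσ

theorem ect_waitOrMove_singleton (x y : Fin 4) (hxy : x ≠ y) :
    waitOrMove.ect ⟨CM 4, [cmProfile x y]⟩ = 2 :=
  ect_waitOrMove_of_isPairHistory hxy ⟨by simp, fun _ hσ => Or.inl (List.mem_singleton.1 hσ)⟩

theorem waitOrMove_isECTOptimal : waitOrMove.IsECTOptimal (CM 4) :=
  Protocol.isECTOptimal_cm waitOrMove_isStructural ect_waitOrMove_singleton

end WaitOrMove

section BlockProtocol

theorem mem_profileBlock {G : WLCGame 2} {σ : G.Profile} {i : Fin 2} {b : Bool} {c : G.Choice i} :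
    c ∈ profileBlock G σ i b ↔ ((c = σ i ∨ c ∈ coordinating G i (σ i.rev)) ↔ b = true) := by
  cases b <;> simp [profileBlock]

theorem mem_profileBlock_cm {x y : Fin 4} {i : Fin 2} {b : Bool} {c : (CM 4).Choice i} :
    c ∈ profileBlock (CM 4) (cmProfile x y) i b ↔
      ((@Eq (Fin 4) c x ∨ @Eq (Fin 4) c y) ↔ b = true) := by
  refine mem_profileBlock.trans (iff_congr ((or_congr_right mem_coordinating_cm).trans ?_) Iff.rfl)
  rcases cmProfile_cases i x y with h | h <;> rw [h.1, h.2.2.1]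
  exacts [Iff.rfl, or_comm]

/-- The pair of the choices `x` and `y`, or the complementary pair. -/
def pairBlock (x y : Fin 4) (b : Bool) : Finset (Fin 4) :=
  Finset.univ.filter fun c => (c = x ∨ c = y) ↔ b = true

theorem mem_pairBlock {x y : Fin 4} {b : Bool} {c : Fin 4} :
    c ∈ pairBlock x y b ↔ ((c = x ∨ c = y) ↔ b = true) := by
  simp [pairBlock]

theorem card_pairBlock {x y : Fin 4} (hxy : x ≠ y) (b : Bool) : (pairBlock x y b).card = 2 := by
  revert x y b; decide

theorem blockProtocol_cm (s : ℕ → Bool) {x y : Fin 4} (hxy : x ≠ y) (T : List (CM 4).Profile)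
    (i : Fin 2) (c : Fin 4) :
    (blockProtocol s).cmStrategy (cmProfile x y :: T) i c =
      if c ∈ pairBlock x y (s T.length) then 1 / 2 else 0 := by
  have hB : ∀ a, a ∈ profileBlock (CM 4) (cmProfile x y) i (s T.length) ↔
      @Membership.mem (Fin 4) (Finset (Fin 4)) _ (pairBlock x y (s T.length)) a :=
    fun a => mem_profileBlock_cm.trans mem_pairBlock.symm
  have hcard := card_pairBlock hxy (s T.length)
  obtain ⟨a, ha⟩ := Finset.card_pos.1 (hcard.symm ▸ two_pos)
  change blockProtocol s ⟨CM 4, cmProfile x y :: T⟩ i c = _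
  rw [blockProtocol_cons, dif_pos ⟨a, (hB a).2 ha⟩]
  exact PMF.uniformOfFinset_apply_of_card_eq_two (α := Fin 4) _ hB hcard c

theorem ect_blockProtocol_singleton (s : ℕ → Bool) (x y : Fin 4) (hxy : x ≠ y) :
    (blockProtocol s).ect ⟨CM 4, [cmProfile x y]⟩ = 2 := by
  refine (blockProtocol s).ect_eq_two_of_win_prob_half
    (fun H => ¬ (Stage.mk (CM 4) H).IsFinal ∧ ∃ T, H = cmProfile x y :: T)
    (fun H hH => hH.1) (fun H hH => ?_) (fun H hH σ hσ _ => ?_) ⟨?_, [], rfl⟩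
  · obtain ⟨-, T, rfl⟩ := hH
    exact (blockProtocol s).win_prob_of_uniform_pair (card_pairBlock hxy _)
      (blockProtocol_cm s hxy T)
  · obtain ⟨hH, T, rfl⟩ := hH
    exact ⟨fun h => ((Protocol.isFinal_extend_iff _ σ).1 h).elim hH hσ, T ++ [σ], rfl⟩
  · rintro ⟨σ, hσ, hw⟩
    obtain rfl := List.mem_singleton.1 hσ
    exact hxy (cmProfile_mem_win_iff.1 hw)

theorem blockProtocol_isECTOptimal (s : ℕ → Bool) : (blockProtocol s).IsECTOptimal (CM 4) :=
  Protocol.isECTOptimal_cm (blockProtocol_isStructural s) (ect_blockProtocol_singleton s)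

theorem reachable_singleton {π : Protocol 2} (hπ : π.IsStructural) {x y : Fin 4} (hxy : x ≠ y) :
    π.Reachable (CM 4) [cmProfile x y] := by
  refine Protocol.Reachable.step [] (cmProfile x y) .initial (mt cmProfile_mem_win_iff.1 hxy) ?_
  rw [Protocol.profileProb_cmProfile, Protocol.cmStrategy_nil hπ, Protocol.cmStrategy_nil hπ]
  simp

theorem exists_reachable_blockProtocol (s : ℕ → Bool) (n : ℕ) :
    ∃ T, T.length = n ∧ (blockProtocol s).Reachable (CM 4) (cmProfile 0 1 :: T) := by
  induction n with
  | zero => exact ⟨[], rfl, reachable_singleton (blockProtocol_isStructural s) (by decide)⟩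
  | succ n ih =>
    obtain ⟨T, rfl, hT⟩ := ih
    have : ∀ b, ∃ x y : Fin 4, x ≠ y ∧ x ∈ pairBlock 0 1 b ∧ y ∈ pairBlock 0 1 b := by decide
    obtain ⟨x, y, hxy, hx, hy⟩ := this (s T.length)
    refine ⟨T ++ [cmProfile x y], by simp, ?_⟩
    refine Protocol.Reachable.step _ _ hT (mt cmProfile_mem_win_iff.1 hxy) ?_
    rw [Protocol.profileProb_cmProfile, blockProtocol_cm s (by decide),
      blockProtocol_cm s (by decide), if_pos hx, if_pos hy]
    simp

namespace Protocol

variable {n : ℕ} {π π' : Protocol n} {G : WLCGame n}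

theorem eq_of_reachableRestrict_eq (h : π.reachableRestrict G = π'.reachableRestrict G)
    {H : List G.Profile} (hH : π.Reachable G H) : π ⟨G, H⟩ = π' ⟨G, H⟩ := by
  have h1 := congrFun h H
  unfold reachableRestrict at h1
  rw [if_pos hH] at h1
  split_ifs at h1
  exact Option.some.inj h1

theorem Reachable.of_restrict_eq (h : π.restrict G = π'.restrict G) {H : List G.Profile}
    (hH : π.Reachable G H) : π'.Reachable G H := by
  induction hH with
  | initial => exact .initial
  | step H σ _ hσ hp ih =>
    refine .step H σ ih hσ ?_
    have h1 : π ⟨G, H⟩ = π' ⟨G, H⟩ := congrFun h H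
    unfold profileProb at hp ⊢
    rwa [← h1]

theorem reachableRestrict_eq_of_restrict_eq (h : π.restrict G = π'.restrict G) :
    π.reachableRestrict G = π'.reachableRestrict G := by
  funext H
  have h1 : π ⟨G, H⟩ = π' ⟨G, H⟩ := congrFun h H
  unfold reachableRestrict
  by_cases hH : π.Reachable G H
  · rw [if_pos hH, if_pos (hH.of_restrict_eq h), h1]
  · rw [if_neg hH, if_neg (mt (Reachable.of_restrict_eq h.symm) hH)]

end Protocol

theorem blockProtocol_reachableRestrict_injective :
    Function.Injective fun s => (blockProtocol s).reachableRestrict (CM 4) := by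
  intro s s' h
  funext n
  obtain ⟨T, rfl, hT⟩ := exists_reachable_blockProtocol s n
  have h1 : (blockProtocol s).cmStrategy (cmProfile 0 1 :: T) 0 0 =
      (blockProtocol s').cmStrategy (cmProfile 0 1 :: T) 0 0 :=
    congrArg (fun p => p 0 (0 : Fin 4)) (Protocol.eq_of_reachableRestrict_eq h hT)
  rw [blockProtocol_cm s (by decide), blockProtocol_cm s' (by decide)] at h1
  have h2 : ∀ b, (0 : Fin 4) ∈ pairBlock 0 1 b ↔ b = true := by decide
  simp only [h2] at h1
  generalize s T.length = b at h1 ⊢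
  generalize s' T.length = b' at h1 ⊢
  cases b <;> cases b'
  · rfl
  · exact absurd h1.symm (by simp)
  · exact absurd h1 (by simp)
  · rfl

/-- The protocols that avoid the first two choices in the second round. -/
noncomputable def avoidingProtocol (s : ℕ → Bool) : Protocol 2 :=
  blockProtocol fun n => n.casesOn false s

theorem avoidingProtocol_isECTOptimal (s : ℕ → Bool) : (avoidingProtocol s).IsECTOptimal (CM 4) :=
  blockProtocol_isECTOptimal _

theorem avoidingProtocol_reachableRestrict_injective :
    Function.Injective fun s => (avoidingProtocol s).reachableRestrict (CM 4) :=
  blockProtocol_reachableRestrict_injective.comp fun _ _ h =>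
    funext fun n => congrFun h (n + 1)

theorem waitOrMove_ne_avoidingProtocol (s : ℕ → Bool) :
    waitOrMove ⟨CM 4, [cmProfile 0 1]⟩ ≠ avoidingProtocol s ⟨CM 4, [cmProfile 0 1]⟩ := by
  intro h
  have h1 : waitOrMove.cmStrategy [cmProfile 0 1] 0 0 =
      (avoidingProtocol s).cmStrategy [cmProfile 0 1] 0 0 :=
    congrArg (fun p => p 0 (0 : Fin 4)) h
  have h2 : (0 : Fin 4) ∉ pairBlock 0 1 false := by decide
  rw [waitOrMove_of_isPairHistory (x := 0) (y := 1) (by decide)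
    ⟨by simp, fun _ hσ => Or.inl (List.mem_singleton.1 hσ)⟩, avoidingProtocol,
    blockProtocol_cm _ (by decide)] at h1
  have h3 := h1.trans (if_neg h2)
  simp at h3

theorem avoidingProtocol_reachableRestrict_ne (s : ℕ → Bool) :
    (avoidingProtocol s).reachableRestrict (CM 4) ≠ waitOrMove.reachableRestrict (CM 4) :=
  fun h => waitOrMove_ne_avoidingProtocol s (Protocol.eq_of_reachableRestrict_eq h.symm
    (reachable_singleton waitOrMove_isStructural (by decide)))

end BlockProtocol

section Cardinality

theorem mk_pmf_fin_le (m : ℕ) : #(PMF (Fin m)) ≤ 𝔠 := by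
  have hinj : Function.Injective fun (p : PMF (Fin m)) a => (p a).toReal := by
    intro p q h
    ext a
    exact (ENNReal.toReal_eq_toReal_iff' (p.apply_ne_top a) (q.apply_ne_top a)).1 (congrFun h a)
  refine (Cardinal.mk_le_of_injective hinj).trans ?_
  rw [← Cardinal.power_def, Cardinal.mk_real]
  refine (Cardinal.power_le_power_left Cardinal.continuum_ne_zero
    (Cardinal.mk_le_aleph0 (α := Fin m))).trans ?_
  rw [Cardinal.continuum_power_aleph0]

theorem mk_cm_strategy_le : #(∀ i, PMF ((CM 4).Choice i)) ≤ 𝔠 := by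
  change #(Fin 2 → PMF (Fin 4)) ≤ 𝔠
  rw [← Cardinal.power_def]
  refine (Cardinal.power_le_power_right (mk_pmf_fin_le 4)).trans ?_
  refine (Cardinal.power_le_power_left Cardinal.continuum_ne_zero
    (Cardinal.mk_le_aleph0 (α := Fin 2))).trans ?_
  rw [Cardinal.continuum_power_aleph0]

theorem mk_cm_history_fun_le {α : Type} (h : #α ≤ 𝔠) : #(List (CM 4).Profile → α) ≤ 𝔠 := by
  have : Countable (CM 4).Profile := inferInstanceAs (Countable (Fin 2 → Fin 4))
  rw [← Cardinal.power_def]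
  refine (Cardinal.power_le_power_right h).trans ?_
  refine (Cardinal.power_le_power_left Cardinal.continuum_ne_zero
    (Cardinal.mk_le_aleph0 (α := List (CM 4).Profile))).trans ?_
  rw [Cardinal.continuum_power_aleph0]

theorem mk_option_cm_strategy_le : #(Option (∀ i, PMF ((CM 4).Choice i))) ≤ 𝔠 := by
  rw [Cardinal.mk_option]
  exact Cardinal.add_le_of_le Cardinal.aleph0_le_continuum mk_cm_strategy_le
    (Cardinal.one_le_aleph0.trans Cardinal.aleph0_le_continuum)

theorem mk_set_eq_continuum {α : Type} (hα : #α ≤ 𝔠) (A : Set α) (g : (ℕ → Bool) → α)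
    (hg : Function.Injective g) (hA : ∀ s, g s ∈ A) : #A = 𝔠 := by
  refine le_antisymm ((Cardinal.mk_set_le A).trans hα) ?_
  have h : #(ℕ → Bool) = 𝔠 := by simp
  rw [← h]
  exact Cardinal.mk_le_of_injective (f := fun s => (⟨g s, hA s⟩ : A))
    fun s s' h => hg (congrArg Subtype.val h)

end Cardinality

theorem mainTheorem9 :
    waitOrMove.IsECTOptimal (CM 4) ∧
    waitOrMove.ect (Stage.initial (CM 4)) = 2 + 1 / 2 ∧
    -- continuum many other optimal protocols, counted by their behaviour in the game
    #{f : List (CM 4).Profile → ∀ i, PMF ((CM 4).Choice i) |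
        f ≠ waitOrMove.restrict (CM 4) ∧
        ∃ π : Protocol 2, π.IsECTOptimal (CM 4) ∧ π.restrict (CM 4) = f} = 𝔠 ∧
    -- the same when only the behaviour at the reachable stages is counted
    #{f : List (CM 4).Profile → Option (∀ i, PMF ((CM 4).Choice i)) |
        f ≠ waitOrMove.reachableRestrict (CM 4) ∧
        ∃ π : Protocol 2, π.IsECTOptimal (CM 4) ∧ π.reachableRestrict (CM 4) = f} = 𝔠 ∧
    -- no protocol is uniquely optimal
    ∀ π : Protocol 2, ¬ π.IsUniquelyECTOptimal (CM 4) := by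
  refine ⟨waitOrMove_isECTOptimal,
    Protocol.ect_initial_cm_eq waitOrMove_isStructural ect_waitOrMove_singleton, ?_, ?_, ?_⟩
  · refine mk_set_eq_continuum (mk_cm_history_fun_le mk_cm_strategy_le) _
      (fun s => (avoidingProtocol s).restrict (CM 4)) (fun s s' h => ?_) fun s => ⟨fun h => ?_, ?_⟩
    · exact avoidingProtocol_reachableRestrict_injective
        (Protocol.reachableRestrict_eq_of_restrict_eq h)
    · exact avoidingProtocol_reachableRestrict_ne s
        (Protocol.reachableRestrict_eq_of_restrict_eq h)
    · exact ⟨_, avoidingProtocol_isECTOptimal s, rfl⟩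
  · exact mk_set_eq_continuum (mk_cm_history_fun_le mk_option_cm_strategy_le) _
      (fun s => (avoidingProtocol s).reachableRestrict (CM 4))
      avoidingProtocol_reachableRestrict_injective fun s =>
        ⟨avoidingProtocol_reachableRestrict_ne s, _, avoidingProtocol_isECTOptimal s, rfl⟩
  · rintro π ⟨hπ, huniq⟩
    have hr : π.Reachable (CM 4) [cmProfile 0 1] := reachable_singleton hπ.1 (by decide)
    exact waitOrMove_ne_avoidingProtocol (fun _ => true)
      ((huniq _ waitOrMove_isECTOptimal _ hr).trans
        (huniq _ (avoidingProtocol_isECTOptimal _) _ hr).symm)
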